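/- Let $M$ and $N$ be smooth manifolds (Hausdorff, second countable, without boundary, each of a fixed finite dimension), let $S\subset N$ be a smooth embedded submanifold of some fixed dimension, and let $f:M\to N$ be a smooth map. Say that a smooth map $h:M\to N$ is transverse to $S$ at $x\in M$ if $h(x)\in S$ implies $T_{h(x)}S+\operatorname{im}(dh_x)=T_{h(x)}N$; that $h$ is transverse to $S$ on a set $A\subset M$ if it is transverse to $S$ at every $x\in A$; and that $h$ is transverse to $S$ if it is transverse to $S$ at every point of $M$. Then $f$ is homotopic to a smooth map $g:M\to N$ which is transverse to $S$. Moreover, if $A\subset M$ is a closed subset such that $f$ is transverse to $S$ on $A$, then $g$ can be chosen such that, in addition, $g|_A=f|_A$. -/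

import Mathlib

open scoped Manifold ContDiff

noncomputable section

namespace Transversality

/-- A set `S` of a smooth `n`-manifold `N`, with a smooth `k`-manifold structure on `S` for the
subspace topology, is a smooth (embedded) `k`-dimensional submanifold of `N` if the inclusion
`S → N` is a smooth embedding. -/
structure IsSubmanifold (k n : ℕ) {N : Type*} [TopologicalSpace N]
    [ChartedSpace (EuclideanSpace ℝ (Fin n)) N]
    (S : Set N) [ChartedSpace (EuclideanSpace ℝ (Fin k)) S] : Prop where
  isManifold : IsManifold (𝓡 k) ∞ S
  isSmoothEmbedding : Manifold.IsSmoothEmbedding (𝓡 k) (𝓡 n) ∞ (Subtype.val : S → N)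

/-- The tangent space `T_y S`, as a subspace of `T_y N`: the image of the differential of the
inclusion `S → N` at `y`. -/
def tangentSubspace (k n : ℕ) {N : Type*} [TopologicalSpace N]
    [ChartedSpace (EuclideanSpace ℝ (Fin n)) N]
    (S : Set N) [ChartedSpace (EuclideanSpace ℝ (Fin k)) S] (y : S) :
    Submodule ℝ (TangentSpace (𝓡 n) (y : N)) :=
  LinearMap.range (mfderiv (𝓡 k) (𝓡 n) (Subtype.val : S → N) y).toLinearMap

/-- `f` is transverse to `S` at `x`: if `f x ∈ S`, then `T_{f x} S + im (df_x) = T_{f x} N`. -/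
def TransverseAt (m k n : ℕ) {M N : Type*}
    [TopologicalSpace M] [ChartedSpace (EuclideanSpace ℝ (Fin m)) M]
    [TopologicalSpace N] [ChartedSpace (EuclideanSpace ℝ (Fin n)) N]
    (S : Set N) [ChartedSpace (EuclideanSpace ℝ (Fin k)) S] (f : M → N) (x : M) : Prop :=
  ∀ h : f x ∈ S,
    tangentSubspace k n S ⟨f x, h⟩ ⊔ LinearMap.range (mfderiv (𝓡 m) (𝓡 n) f x).toLinearMap = ⊤

/-- `f` is transverse to `S` on the set `A` of points of the source. -/
def TransverseOn (m k n : ℕ) {M N : Type*}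
    [TopologicalSpace M] [ChartedSpace (EuclideanSpace ℝ (Fin m)) M]
    [TopologicalSpace N] [ChartedSpace (EuclideanSpace ℝ (Fin n)) N]
    (S : Set N) [ChartedSpace (EuclideanSpace ℝ (Fin k)) S] (f : M → N) (A : Set M) : Prop :=
  ∀ x ∈ A, TransverseAt m k n S f x

/-- `f` is transverse to `S`. -/
def Transverse (m k n : ℕ) {M N : Type*}
    [TopologicalSpace M] [ChartedSpace (EuclideanSpace ℝ (Fin m)) M]
    [TopologicalSpace N] [ChartedSpace (EuclideanSpace ℝ (Fin n)) N]
    (S : Set N) [ChartedSpace (EuclideanSpace ℝ (Fin k)) S] (f : M → N) : Prop :=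
  ∀ x, TransverseAt m k n S f x

end Transversality

end

noncomputable section

namespace Transversality

open Set Module Topology Filter

/-! ### Dimension count for the bad affine perturbations in Euclidean space. -/

section Euclidean

variable {X Y Z F : Type*}
  [NormedAddCommGroup X] [NormedSpace ℝ X] [NormedAddCommGroup Y] [NormedSpace ℝ Y]
  [NormedAddCommGroup Z] [NormedSpace ℝ Z] [NormedAddCommGroup F] [NormedSpace ℝ F]

/-! Cover `M` by a countable locally finite family of relatively compact open sets `W i`, each
inside a chart and mapped by `f` into a chart, and perturb on the sets `W i \ A` successively. In
charts, one step adds `ρ` times an affine map `a + B x`, where `ρ ≥ 0` is smooth with support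
exactly the set being treated.

Where `ρ ≠ 0`, the value and differential at a given point determine `(a, B)`. So the bad parameters
are covered by countably many `C¹` images of spaces of non-transverse 1-jets, whose dimension is one
less than that of the parameter space (`dimH_setOf_not_transverse_le`). Hausdorff dimension thus
does the work of Sard's theorem, and arbitrarily small good parameters exist
(`dense_setOf_transverse`).

Where `ρ = 0`, its differential vanishes too, so the 1-jet of the map is unchanged. Hence
transversality at a point, once gained, is never lost (`exists_transverse_step`), without any appeal
to its openness or to closedness of `S`. Points of `A` never move. By local finiteness the maps
stabilise near each point, and so do the concatenated homotopies, up to and including time `1`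
(`exists_limit_homotopy`). -/

theorem dimH_image_le_finrank_of_isOpen [FiniteDimensional ℝ X] {f : X → Y} {s : Set X} (hs : IsOpen s)
    (hf : ContDiffOn ℝ 1 f s) : dimH (f '' s) ≤ finrank ℝ X := by
  rw [← Real.dimH_univ_eq_finrank X]
  refine (dimH_image_le_of_locally_lipschitzOn fun x hx ↦ ?_).trans (dimH_mono (subset_univ s))
  obtain ⟨C, t, ht, hC⟩ := (hf.contDiffAt (hs.mem_nhds hx)).exists_lipschitzOnWith
  exact ⟨C, t, mem_nhdsWithin_of_mem_nhds ht, hC⟩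

theorem finrank_continuousLinearMap [FiniteDimensional ℝ X] [FiniteDimensional ℝ Y] :
    finrank ℝ (X →L[ℝ] Y) = finrank ℝ X * finrank ℝ Y := by
  rw [← finrank_linearMap ℝ ℝ X Y]
  exact (LinearMap.toContinuousLinearMap (𝕜 := ℝ) (E := X) (F' := Y)).finrank_eq.symm

/-- A linear map which is not onto takes its values in a hyperplane, and this hyperplane is the
graph of a linear form on one of the coordinate hyperplanes. -/
theorem exists_eq_add_smul_of_range_ne_top [FiniteDimensional ℝ F] {ι : Type*} (b : Basis ι ℝ F)
    (L : X →L[ℝ] F) (hL : LinearMap.range L.toLinearMap ≠ ⊤) :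
    ∃ i, ∃ ν : LinearMap.ker (b.coord i) →L[ℝ] ℝ, ∃ K : X →L[ℝ] LinearMap.ker (b.coord i),
      ∀ x, L x = (K x : F) + ν (K x) • b i := by
  -- The range lies in `ker l`. If `l (b i) ≠ 0`, then `ker l` is a graph over the `i`-th coordinate
  -- hyperplane, and `K` is `L` projected there along `b i`.
  obtain ⟨l, hl0, hl⟩ := Submodule.exists_le_ker_of_lt_top _ (lt_top_iff_ne_top.2 hL)
  obtain ⟨i, hi⟩ : ∃ i, l (b i) ≠ 0 := by
    by_contra! h
    exact hl0 (b.ext fun i ↦ by simpa using h i)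
  have hlL (x : X) : l (L x) = 0 := hl ⟨x, rfl⟩
  let K : X →L[ℝ] F := L - (LinearMap.toContinuousLinearMap (b.coord i) ∘L L).smulRight (b i)
  have hK (x : X) : K x = L x - b.coord i (L x) • b i := rfl
  refine ⟨i, LinearMap.toContinuousLinearMap (-(l (b i))⁻¹ • l ∘ₗ Submodule.subtype _),
    K.codRestrict _ fun x ↦ ?_, fun x ↦ ?_⟩
  · simp [hK]
  · have : (l (b i))⁻¹ * (b.repr (L x) i * l (b i)) = b.repr (L x) i := by field_simp
    simp [hK, hlL, this]

variable (X Z) in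
/-- The space parametrizing a point of `X`, a point of `Z`, a linear map from `X` to `Z` and
a linear map from `X` to a hyperplane that is a graph over the hyperplane `G`. -/
abbrev HyperplaneParam (G : Submodule ℝ F) : Type _ :=
  X × Z × (X →L[ℝ] Z) × (G →L[ℝ] ℝ) × (X →L[ℝ] G)

/-- For almost all `(a, B)`, the map `x ↦ u x + c x • (a + B x)` is transverse to the slice
`Θ (Z × 0)`: the exceptional parameters are a smooth image of a space of smaller dimension. -/
theorem dimH_setOf_not_transverse_le [FiniteDimensional ℝ X] [FiniteDimensional ℝ Y]
    [FiniteDimensional ℝ Z] [FiniteDimensional ℝ F] {Ω : Set X} (hΩ : IsOpen Ω) {u : X → Y}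
    (hu : ContDiffOn ℝ ∞ u Ω) {c : X → ℝ} (hc : ContDiffOn ℝ ∞ c Ω) (hc0 : ∀ x ∈ Ω, c x ≠ 0)
    {D : Set (Z × F)} (hD : IsOpen D) {Θ : Z × F → Y} (hΘ : ContDiffOn ℝ ∞ Θ D)
    (hΘ' : ∀ p ∈ D, LinearMap.range (fderiv ℝ Θ p).toLinearMap = ⊤)
    (hdim : finrank ℝ Y = finrank ℝ Z + finrank ℝ F) :
    dimH {s : Y × (X →L[ℝ] Y) | ∃ x ∈ Ω, ∃ z, (z, 0) ∈ D ∧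
      Θ (z, 0) = u x + c x • (s.1 + s.2 x) ∧
      LinearMap.range (fderiv ℝ Θ (z, 0) ∘L .inl ℝ Z F).toLinearMap ⊔
        LinearMap.range (fderiv ℝ (fun x ↦ u x + c x • (s.1 + s.2 x)) x).toLinearMap ≠ ⊤}
      ≤ ((finrank ℝ (Y × (X →L[ℝ] Y)) - 1 : ℕ) : ENNReal) := by
  let b := Module.finBasis ℝ F
  let G (i : Fin (finrank ℝ F)) : Submodule ℝ F := LinearMap.ker (b.coord i)
  let Q (i : Fin (finrank ℝ F)) := HyperplaneParam X Z (G i)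
  let V (i : Fin (finrank ℝ F)) : Set (Q i) := {q | q.1 ∈ Ω ∧ (q.2.1, (0 : F)) ∈ D}
  -- `p` is the value of `a + B x` forced by hitting `Θ (z, 0)`, and `L` is the prescribed
  -- non-transverse differential. Dividing by `c x ≠ 0` in the product rule gives `B`, and then `a =
  -- p - B x`.
  let p (i : Fin (finrank ℝ F)) (q : Q i) : Y := (c q.1)⁻¹ • (Θ (q.2.1, 0) - u q.1)
  let L (i : Fin (finrank ℝ F)) (q : Q i) : X →L[ℝ] Y :=
    fderiv ℝ Θ (q.2.1, 0) ∘L (.inl ℝ Z F ∘L q.2.2.1 + .inr ℝ Z F ∘L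
      ((G i).subtypeL ∘L q.2.2.2.2 + (q.2.2.2.1 ∘L q.2.2.2.2).smulRight (b i)))
  let B (i : Fin (finrank ℝ F)) (q : Q i) : X →L[ℝ] Y :=
    (c q.1)⁻¹ • (L i q - fderiv ℝ u q.1 - (fderiv ℝ c q.1).smulRight (p i q))
  let Ψ (i : Fin (finrank ℝ F)) (q : Q i) : Y × (X →L[ℝ] Y) := (p i q - B i q q.1, B i q)
  have hV (i) : IsOpen (V i) :=
    (hΩ.preimage continuous_fst).inter (hD.preimage (by fun_prop))
  have hfst (i) : ContDiffOn ℝ ∞ (fun q : Q i ↦ q.1) (V i) := contDiff_fst.contDiffOn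
  have hz (i) : ContDiffOn ℝ ∞ (fun q : Q i ↦ (q.2.1, (0 : F))) (V i) := by fun_prop
  have hcV (i) : ContDiffOn ℝ ∞ (fun q : Q i ↦ (c q.1)⁻¹) (V i) :=
    (hc.comp (hfst i) fun q hq ↦ hq.1).inv fun q hq ↦ hc0 _ hq.1
  have hp (i) : ContDiffOn ℝ ∞ (p i) (V i) :=
    (hcV i).smul ((hΘ.comp (hz i) fun q hq ↦ hq.2).sub (hu.comp (hfst i) fun q hq ↦ hq.1))
  have hL (i) : ContDiffOn ℝ ∞ (L i) (V i) := by
    refine ((hΘ.fderiv_of_isOpen hD (m := ∞) (by simp)).comp (hz i) fun q hq ↦ hq.2).clm_comp ?_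
    have h1 : ContDiff ℝ ∞ (fun q : Q i ↦ q.2.2.1) := by fun_prop
    have h2 : ContDiff ℝ ∞ (fun q : Q i ↦ q.2.2.2.1) := by fun_prop
    have h3 : ContDiff ℝ ∞ (fun q : Q i ↦ q.2.2.2.2) := by fun_prop
    exact ((contDiff_const.clm_comp h1).add (contDiff_const.clm_comp
      ((contDiff_const.clm_comp h3).add ((h2.clm_comp h3).smulRight contDiff_const)))).contDiffOn
  have hB (i) : ContDiffOn ℝ ∞ (B i) (V i) :=
    (hcV i).smul (((hL i).sub
      ((hu.fderiv_of_isOpen hΩ (m := ∞) (by simp)).comp (hfst i) fun q hq ↦ hq.1)).sub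
      (((hc.fderiv_of_isOpen hΩ (m := ∞) (by simp)).comp (hfst i) fun q hq ↦ hq.1).smulRight
        (hp i)))
  have hΨ (i) : ContDiffOn ℝ 1 (Ψ i) (V i) :=
    (((hp i).sub ((hB i).clm_apply (hfst i))).prodMk (hB i)).of_le (by simp)
  -- With dimensions `m`, `k`, `q` of `X`, `Z`, `F`: `m + k + mk + (q - 1) + m(q - 1) = (k + q)(1 +
  -- m) - 1`. The hyperplane condition costs `m + 1`, and the choice of `x` gives back only `m`.
  have hrank (i) : finrank ℝ (Q i) = finrank ℝ (Y × (X →L[ℝ] Y)) - 1 := by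
    have hG : finrank ℝ (G i) + 1 = finrank ℝ F := by
      have := (b.coord i).finrank_range_add_finrank_ker
      rw [LinearMap.range_eq_top.2 (LinearMap.surjective (fun h ↦ by
        simpa using DFunLike.congr_fun h (b i))), finrank_top, finrank_self] at this
      change finrank ℝ (LinearMap.ker (b.coord i)) + 1 = _
      omega
    simp only [Q, HyperplaneParam, finrank_prod, finrank_continuousLinearMap, finrank_self, hdim, ← hG]
    grind
  refine (dimH_mono (t := ⋃ i, Ψ i '' V i) ?_).trans ?_
  · rintro ⟨a, B₀⟩ ⟨x, hx, z, hzD, hzx, hne⟩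
    have hux : DifferentiableAt ℝ u x := (hu.contDiffAt (hΩ.mem_nhds hx)).differentiableAt (by simp)
    have hcx : DifferentiableAt ℝ c x := (hc.contDiffAt (hΩ.mem_nhds hx)).differentiableAt (by simp)
    have hder : fderiv ℝ (fun x ↦ u x + c x • (a + B₀ x)) x =
        fderiv ℝ u x + (c x • B₀ + (fderiv ℝ c x).smulRight (a + B₀ x)) := by
      refine (hux.hasFDerivAt.add (hcx.hasFDerivAt.smul ?_)).fderiv
      exact B₀.hasFDerivAt.const_add a
    simp only [hder] at hne
    set L₀ := fderiv ℝ u x + (c x • B₀ + (fderiv ℝ c x).smulRight (a + B₀ x)) with hL₀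
    obtain ⟨R, hR⟩ := (fderiv ℝ Θ (z, 0)).toLinearMap.exists_rightInverse_of_surjective
      (hΘ' _ hzD)
    have hR' (y : Y) : fderiv ℝ Θ (z, 0) (R y) = y := LinearMap.congr_fun hR y
    let R' : Y →L[ℝ] Z × F := LinearMap.toContinuousLinearMap R
    -- In slice coordinates, failure of transversality means that the normal component of `L₀` is
    -- not onto `F`.
    obtain ⟨i, ν, K, hK⟩ := exists_eq_add_smul_of_range_ne_top b
      (.snd ℝ Z F ∘L R' ∘L L₀) (fun htop ↦ hne <| by
        refine eq_top_iff.2 fun y _ ↦ ?_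
        obtain ⟨v, hv⟩ : (R y).2 ∈ LinearMap.range (.snd ℝ Z F ∘L R' ∘L L₀).toLinearMap :=
          htop ▸ Submodule.mem_top
        have hv' : (R (L₀ v)).2 = (R y).2 := hv
        refine Submodule.mem_sup.2 ⟨_, ⟨(R (y - L₀ v)).1, rfl⟩, _, ⟨v, rfl⟩, ?_⟩
        have : ((R (y - L₀ v)).1, (0 : F)) = R (y - L₀ v) := by
          ext <;> simp [hv']
        change fderiv ℝ Θ (z, 0) ((R (y - L₀ v)).1, 0) + L₀ v = y
        rw [this, hR', sub_add_cancel])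
    refine mem_iUnion.2 ⟨i, ⟨x, z, .fst ℝ Z F ∘L R' ∘L L₀, ν, K⟩, ⟨hx, hzD⟩, ?_⟩
    have hpx : p i ⟨x, z, .fst ℝ Z F ∘L R' ∘L L₀, ν, K⟩ = a + B₀ x := by
      simp [p, hzx, smul_smul, hc0 x hx]
    have hLx : L i ⟨x, z, .fst ℝ Z F ∘L R' ∘L L₀, ν, K⟩ = L₀ := by
      ext1 v
      have h2 : ((K v : F) + ν (K v) • b i) = (R (L₀ v)).2 := (hK v).symm
      rw [← hR' (L₀ v)]
      change fderiv ℝ Θ (z, 0) (((R (L₀ v)).1, 0) + (0, (K v : F) + ν (K v) • b i)) = _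
      rw [h2]
      simp
    have hBx : B i ⟨x, z, .fst ℝ Z F ∘L R' ∘L L₀, ν, K⟩ = B₀ := by
      simp only [B, hpx, hLx]
      rw [hL₀, show fderiv ℝ u x + (c x • B₀ + (fderiv ℝ c x).smulRight (a + B₀ x)) - fderiv ℝ u x -
        (fderiv ℝ c x).smulRight (a + B₀ x) = c x • B₀ by abel, smul_smul,
        inv_mul_cancel₀ (hc0 x hx), one_smul]
    simp only [Ψ, hpx, hBx, add_sub_cancel_right]
  · rw [dimH_iUnion]
    refine iSup_le fun i ↦ ?_
    have := dimH_image_le_finrank_of_isOpen (hV i) (hΨ i)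
    rwa [hrank i] at this

theorem dense_compl_iUnion_of_dimH_le [FiniteDimensional ℝ X] {ι : Type*} [Countable ι]
    {s : ι → Set X}
    (h0 : 0 < finrank ℝ X) (hs : ∀ i, dimH (s i) ≤ ((finrank ℝ X - 1 : ℕ) : ENNReal)) :
    Dense (⋃ i, s i)ᶜ := by
  refine dense_compl_of_dimH_lt_finrank ?_
  rw [dimH_iUnion]
  refine (iSup_le hs).trans_lt ?_
  exact_mod_cast Nat.sub_lt h0 one_pos

end Euclidean

/-! ### Smooth transition maps between charts of the target. -/

section SliceMap

variable {n : ℕ} {N E : Type*} [TopologicalSpace N] [NormedAddCommGroup E] [NormedSpace ℝ E]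

/-- The transition map from the chart `κ`, read through the linear equivalence `A`, to the
chart `φ`. -/
def sliceMap (A : E ≃L[ℝ] EuclideanSpace ℝ (Fin n))
    (κ φ : OpenPartialHomeomorph N (EuclideanSpace ℝ (Fin n))) :
    OpenPartialHomeomorph E (EuclideanSpace ℝ (Fin n)) :=
  A.toHomeomorph.toOpenPartialHomeomorph.trans (κ.symm.trans φ)

variable (A : E ≃L[ℝ] EuclideanSpace ℝ (Fin n))
  {κ φ : OpenPartialHomeomorph N (EuclideanSpace ℝ (Fin n))}

theorem sliceMap_apply (p : E) : sliceMap A κ φ p = φ (κ.symm (A p)) := rfl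

theorem mem_sliceMap_source {p : E} :
    p ∈ (sliceMap A κ φ).source ↔ A p ∈ κ.target ∧ κ.symm (A p) ∈ φ.source := by
  simp [sliceMap]

theorem mem_sliceMap_target {p : EuclideanSpace ℝ (Fin n)} :
    p ∈ (sliceMap A κ φ).target ↔ p ∈ φ.target ∧ φ.symm p ∈ κ.source := by
  simp [sliceMap]

variable [ChartedSpace (EuclideanSpace ℝ (Fin n)) N]

theorem contMDiffOn_sliceMap (hκ : κ ∈ IsManifold.maximalAtlas (𝓡 n) ∞ N)
    (hφ : φ ∈ IsManifold.maximalAtlas (𝓡 n) ∞ N) :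
    ContMDiffOn 𝓘(ℝ, E) (𝓡 n) ∞ (sliceMap A κ φ) (sliceMap A κ φ).source := by
  have h1 : ContMDiffOn 𝓘(ℝ, E) (𝓡 n) ∞ A (sliceMap A κ φ).source :=
    A.contDiff.contMDiff.contMDiffOn
  have h2 : ContMDiffOn 𝓘(ℝ, E) (𝓡 n) ∞ (κ.symm ∘ A) (sliceMap A κ φ).source :=
    (contMDiffOn_symm_of_mem_maximalAtlas hκ).comp h1
      fun p hp ↦ ((mem_sliceMap_source A).1 hp).1
  exact (contMDiffOn_of_mem_maximalAtlas hφ).comp h2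
    fun p hp ↦ ((mem_sliceMap_source A).1 hp).2

theorem contMDiffOn_sliceMap_symm (hκ : κ ∈ IsManifold.maximalAtlas (𝓡 n) ∞ N)
    (hφ : φ ∈ IsManifold.maximalAtlas (𝓡 n) ∞ N) :
    ContMDiffOn (𝓡 n) 𝓘(ℝ, E) ∞ (sliceMap A κ φ).symm (sliceMap A κ φ).target := by
  have h1 : ContMDiffOn (𝓡 n) (𝓡 n) ∞ φ.symm (sliceMap A κ φ).target :=
    (contMDiffOn_symm_of_mem_maximalAtlas hφ).mono fun p hp ↦ ((mem_sliceMap_target A).1 hp).1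
  have h2 : ContMDiffOn (𝓡 n) (𝓡 n) ∞ (κ ∘ φ.symm) (sliceMap A κ φ).target :=
    (contMDiffOn_of_mem_maximalAtlas hκ).comp h1
      fun p hp ↦ ((mem_sliceMap_target A).1 hp).2
  have h3 : ContMDiff (𝓡 n) 𝓘(ℝ, E) ∞ A.symm := A.symm.contDiff.contMDiff
  exact h3.comp_contMDiffOn h2

theorem mdifferentiable_sliceMap (hκ : κ ∈ IsManifold.maximalAtlas (𝓡 n) ∞ N)
    (hφ : φ ∈ IsManifold.maximalAtlas (𝓡 n) ∞ N) : (sliceMap A κ φ).MDifferentiable 𝓘(ℝ, E) (𝓡 n) :=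
  ⟨(contMDiffOn_sliceMap A hκ hφ).mdifferentiableOn (by simp),
    (contMDiffOn_sliceMap_symm A hκ hφ).mdifferentiableOn (by simp)⟩

end SliceMap

/-! ### Transversality in charts and its dependence on the 1-jet. -/

section Charts

variable {m k n : ℕ} {M N : Type*}
  [TopologicalSpace M] [ChartedSpace (EuclideanSpace ℝ (Fin m)) M]
  [TopologicalSpace N] [ChartedSpace (EuclideanSpace ℝ (Fin n)) N]
  {S : Set N} [ChartedSpace (EuclideanSpace ℝ (Fin k)) S]

theorem TransverseAt.congr_of_mfderiv_eq {g g' : M → N} {x : M} (h : TransverseAt m k n S g x)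
    (hx : g' x = g x)
    (hd : (mfderiv (𝓡 m) (𝓡 n) g' x : EuclideanSpace ℝ (Fin m) →L[ℝ] EuclideanSpace ℝ (Fin n)) =
      mfderiv (𝓡 m) (𝓡 n) g x) : TransverseAt m k n S g' x := by
  -- Making the point and the differential independent arguments allows rewriting despite the
  -- tangent spaces depending on the point.
  let P (y : N) (L : EuclideanSpace ℝ (Fin m) →L[ℝ] EuclideanSpace ℝ (Fin n)) : Prop :=
    ∀ h : y ∈ S, (tangentSubspace k n S ⟨y, h⟩ : Submodule ℝ (EuclideanSpace ℝ (Fin n))) ⊔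
      LinearMap.range L.toLinearMap = ⊤
  change P (g x) (mfderiv (𝓡 m) (𝓡 n) g x) at h
  change P (g' x) (mfderiv (𝓡 m) (𝓡 n) g' x)
  rwa [hx, hd]

theorem TransverseAt.congr_of_eventuallyEq {g g' : M → N} {x : M} (h : TransverseAt m k n S g x)
    (hg : g' =ᶠ[𝓝 x] g) : TransverseAt m k n S g' x :=
  h.congr_of_mfderiv_eq hg.eq_of_nhds hg.mfderiv_eq

theorem transverseAt_of_chart {g : M → N} {x : M}
    (hg : MDifferentiableAt (𝓡 m) (𝓡 n) g x)
    {φ : OpenPartialHomeomorph N (EuclideanSpace ℝ (Fin n))} (hφ : φ.MDifferentiable (𝓡 n) (𝓡 n))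
    (hx : g x ∈ φ.source)
    (h : ∀ hS : g x ∈ S,
      (tangentSubspace k n S ⟨g x, hS⟩).map (mfderiv (𝓡 n) (𝓡 n) φ (g x)).toLinearMap ⊔
        LinearMap.range (mfderiv (𝓡 m) (𝓡 n) (φ ∘ g) x).toLinearMap = ⊤) :
    TransverseAt m k n S g x := by
  intro hS
  refine Submodule.map_injective_of_injective (hφ.mfderiv_injective hx) ?_
  have := h hS
  rw [mfderiv_comp x (hφ.mdifferentiableAt hx) hg] at this
  refine Eq.trans ?_ (this.trans ?_)
  · rw [Submodule.map_sup]
    congr 1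
    exact (LinearMap.range_comp _ _).symm
  · exact ((Submodule.map_top _).trans (LinearMap.range_eq_top.2 (hφ.mfderiv_surjective hx))).symm

theorem mdifferentiable_of_mem_maximalAtlas {φ : OpenPartialHomeomorph N (EuclideanSpace ℝ (Fin n))}
    (hφ : φ ∈ IsManifold.maximalAtlas (𝓡 n) ∞ N) : φ.MDifferentiable (𝓡 n) (𝓡 n) :=
  ⟨(contMDiffOn_of_mem_maximalAtlas hφ).mdifferentiableOn (by simp),
    (contMDiffOn_symm_of_mem_maximalAtlas hφ).mdifferentiableOn (by simp)⟩

/-- Near each of its points a submanifold is, in a given chart `φ` of the ambient manifold, a slice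
`Θ (ℝᵏ × 0)` of a local diffeomorphism `Θ`. -/
theorem exists_slice {F : Type*} [NormedAddCommGroup F] [NormedSpace ℝ F]
    {φ : OpenPartialHomeomorph N (EuclideanSpace ℝ (Fin n))}
    (hφ : φ ∈ IsManifold.maximalAtlas (𝓡 n) ∞ N) (y : S)
    (hy : Manifold.IsImmersionAtOfComplement F (𝓡 k) (𝓡 n) ∞ (Subtype.val : S → N) y) :
    ∃ U ∈ 𝓝 y, ∃ (D : Set (EuclideanSpace ℝ (Fin k) × F))
      (Θ : EuclideanSpace ℝ (Fin k) × F → EuclideanSpace ℝ (Fin n)),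
      IsOpen D ∧ ContDiffOn ℝ ∞ Θ D ∧
      (∀ p ∈ D, LinearMap.range (fderiv ℝ Θ p).toLinearMap = ⊤) ∧
      ∀ y' ∈ U, (y' : N) ∈ φ.source → ∃ z, (z, 0) ∈ D ∧ Θ (z, 0) = φ y' ∧
        LinearMap.range (fderiv ℝ Θ (z, 0) ∘L .inl ℝ _ F).toLinearMap ≤
          (tangentSubspace k n S y').map (mfderiv (𝓡 n) (𝓡 n) φ y').toLinearMap := by
  have hcod := hy.codChart_mem_maximalAtlas
  set e := sliceMap hy.equiv hy.codChart φ with he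
  refine ⟨hy.domChart.source, hy.domChart.open_source.mem_nhds hy.mem_domChart_source,
    e.source, e, e.open_source,
    (contMDiffOn_sliceMap _ hcod hφ).contDiffOn, fun p hp ↦ ?_, fun y' hy' hy'φ ↦ ?_⟩
  · rw [← mfderiv_eq_fderiv]
    exact (mdifferentiable_sliceMap _ hcod hφ).range_mfderiv_eq_top hp
  set z := hy.domChart y' with hz
  have hzt : z ∈ hy.domChart.target := hy.domChart.map_source hy'
  -- The normal form of an immersion: in suitable charts the inclusion is `w ↦ (w, 0)`.
  have hw : ∀ w ∈ hy.domChart.target,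
      hy.equiv (w, 0) = hy.codChart (hy.domChart.symm w : S) := fun w hw ↦ by
    have h : w ∈ (hy.domChart.extend (𝓡 k)).target := by simpa using hw
    simpa using (hy.writtenInCharts h).symm
  have hsrc : ∀ w ∈ hy.domChart.target, ((hy.domChart.symm w : S) : N) ∈ hy.codChart.source :=
    fun w hw ↦ hy.source_subset_preimage_source (hy.domChart.map_target hw)
  have hzy : hy.domChart.symm z = y' := hy.domChart.left_inv hy'
  have hval : ∀ w ∈ hy.domChart.target, e (w, 0) = φ (hy.domChart.symm w : S) := fun w h ↦ by
    rw [he, sliceMap_apply, hw w h, hy.codChart.left_inv (hsrc w h)]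
  have hzD : (z, 0) ∈ e.source := by
    rw [he, mem_sliceMap_source, hw z hzt, hy.codChart.left_inv (hsrc z hzt), hzy]
    exact ⟨hy.codChart.map_source (hzy ▸ hsrc z hzt), hy'φ⟩
  refine ⟨z, hzD, by rw [hval z hzt, hzy], ?_⟩
  clear_value z
  subst hzy
  have hdom : MDifferentiableAt (𝓡 k) (𝓡 k) hy.domChart.symm z :=
    ((contMDiffOn_symm_of_mem_maximalAtlas hy.domChart_mem_maximalAtlas).mdifferentiableOn
      (by simp)).mdifferentiableAt (hy.domChart.open_target.mem_nhds hzt)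
  have hinc : MDifferentiableAt (𝓡 k) (𝓡 n) (Subtype.val : S → N) (hy.domChart.symm z) :=
    ((hy.contMDiffOn).mdifferentiableOn (by simp)).mdifferentiableAt
      (hy.domChart.open_source.mem_nhds hy')
  have hφd : MDifferentiableAt (𝓡 n) (𝓡 n) φ (hy.domChart.symm z : S) :=
    (mdifferentiable_of_mem_maximalAtlas hφ).mdifferentiableAt hy'φ
  have hcomp : MDifferentiableAt (𝓡 k) (𝓡 n) (Subtype.val ∘ hy.domChart.symm) z :=
    hinc.comp z hdom
  have hderiv : mfderiv (𝓡 k) (𝓡 n) (φ ∘ Subtype.val ∘ hy.domChart.symm) z =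
      fderiv ℝ e (z, 0) ∘L .inl ℝ _ F := by
    have hev : (φ ∘ Subtype.val ∘ hy.domChart.symm) =ᶠ[𝓝 z] fun w ↦ e (w, 0) := by
      filter_upwards [hy.domChart.open_target.mem_nhds hzt] with w hw using (hval w hw).symm
    rw [hev.mfderiv_eq, mfderiv_eq_fderiv]
    have hed : DifferentiableAt ℝ e (z, 0) :=
      ((contMDiffOn_sliceMap _ hcod hφ).contDiffOn.contDiffAt
        (e.open_source.mem_nhds hzD)).differentiableAt (by simp)
    exact (hed.hasFDerivAt.comp z (hasFDerivAt_prodMk_left z 0)).fderiv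
  rw [mfderiv_comp z hφd hcomp, mfderiv_comp z hinc hdom] at hderiv
  rw [← hderiv]
  rintro _ ⟨v, rfl⟩
  exact ⟨_, ⟨_, rfl⟩, rfl⟩

/-- A nonnegative function has a minimum at each of its zeros, so its differential vanishes there
and both terms of the product rule are zero. -/
theorem hasMFDerivAt_smul_zero {ρ : M → ℝ} {h : M → EuclideanSpace ℝ (Fin n)} {x : M}
    (hρ : MDifferentiableAt (𝓡 m) 𝓘(ℝ, ℝ) ρ x) (hρ0 : ρ x = 0) (hnn : ∀ y, 0 ≤ ρ y)
    (hh : MDifferentiableAt (𝓡 m) (𝓡 n) h x) :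
    HasMFDerivAt (𝓡 m) (𝓡 n) (fun y ↦ ρ y • h y) x 0 := by
  refine ⟨hρ.continuousAt.smul hh.continuousAt, ?_⟩
  have hr : range (𝓡 m) = univ := ModelWithCorners.range_eq_univ _
  obtain ⟨ρ', h1⟩ : ∃ ρ' : EuclideanSpace ℝ (Fin m) →L[ℝ] ℝ,
      HasFDerivAt (ρ ∘ (extChartAt (𝓡 m) x).symm) ρ' (extChartAt (𝓡 m) x x) :=
    ⟨_, hasFDerivWithinAt_univ.1 (hr ▸ hρ.hasMFDerivAt.2)⟩
  obtain ⟨h', h2⟩ : ∃ h' : EuclideanSpace ℝ (Fin m) →L[ℝ] EuclideanSpace ℝ (Fin n),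
      HasFDerivAt (h ∘ (extChartAt (𝓡 m) x).symm) h' (extChartAt (𝓡 m) x x) :=
    ⟨_, hasFDerivWithinAt_univ.1 (hr ▸ hh.hasMFDerivAt.2)⟩
  have hx : (ρ ∘ (extChartAt (𝓡 m) x).symm) (extChartAt (𝓡 m) x x) = 0 := by simp [hρ0]
  have h0 : IsLocalMin (ρ ∘ (extChartAt (𝓡 m) x).symm) (extChartAt (𝓡 m) x x) :=
    Filter.Eventually.of_forall fun y ↦ by rw [hx]; exact hnn _
  rw [h0.hasFDerivAt_eq_zero h1] at h1
  have h3 := h1.smul h2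
  rw [hx, zero_smul, zero_add] at h3
  refine (h3.congr_fderiv ?_).hasFDerivWithinAt
  exact ContinuousLinearMap.ext fun v ↦ zero_smul ℝ _

/-- Adding, in a chart, a map which vanishes to first order at `x` does not affect transversality
at `x`. -/
theorem TransverseAt.perturb {g g' : M → N} {x : M}
    (h : TransverseAt m k n S g x) (hg : MDifferentiableAt (𝓡 m) (𝓡 n) g x)
    {φ : OpenPartialHomeomorph N (EuclideanSpace ℝ (Fin n))} (hφ : φ.MDifferentiable (𝓡 n) (𝓡 n))
    (hx : g x ∈ φ.source) {β : M → EuclideanSpace ℝ (Fin n)} (hβ0 : β x = 0)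
    (hβ : HasMFDerivAt (𝓡 m) (𝓡 n) β x 0)
    (hg' : g' =ᶠ[𝓝 x] fun y ↦ φ.symm (φ (g y) + β y)) : TransverseAt m k n S g' x := by
  have h1 : HasMFDerivAt (𝓡 m) (𝓡 n) (φ ∘ g + β) x
      (mfderiv (𝓡 m) (𝓡 n) (φ ∘ g) x) := by
    have := ((hφ.mdifferentiableAt hx).comp x hg).hasMFDerivAt.add hβ
    exact this.congr_mfderiv (add_zero _)
  have hx1 : (φ ∘ g + β) x = φ (g x) := by simp [hβ0]
  have h2 := (hφ.mdifferentiableAt_symm (φ.map_source hx)).hasMFDerivAt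
  have h3 : HasMFDerivAt (𝓡 m) (𝓡 n) (φ.symm ∘ (φ ∘ g + β)) x
      ((mfderiv (𝓡 n) (𝓡 n) φ.symm (φ (g x))) ∘L (mfderiv (𝓡 m) (𝓡 n) (φ ∘ g) x)) :=
    HasMFDerivAt.comp x (by rw [hx1]; exact h2) h1
  have h4 : HasMFDerivAt (𝓡 m) (𝓡 n) (φ.symm ∘ (φ ∘ g)) x
      ((mfderiv (𝓡 n) (𝓡 n) φ.symm (φ (g x))) ∘L (mfderiv (𝓡 m) (𝓡 n) (φ ∘ g) x)) :=
    HasMFDerivAt.comp x h2 ((hφ.mdifferentiableAt hx).comp x hg).hasMFDerivAt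
  have h5 : g =ᶠ[𝓝 x] φ.symm ∘ (φ ∘ g) := by
    filter_upwards [hg.continuousAt.preimage_mem_nhds (φ.open_source.mem_nhds hx)] with y hy
    exact (φ.left_inv hy).symm
  refine h.congr_of_mfderiv_eq ?_ ?_
  · rw [hg'.eq_of_nhds, hβ0, add_zero, φ.left_inv hx]
  · exact (h3.congr_of_eventuallyEq hg').mfderiv.trans
      (h4.congr_of_eventuallyEq h5).mfderiv.symm

end Charts

/-! ### One perturbation step in a pair of charts. -/

section Perturbation

variable {m k n : ℕ} {M N : Type*} [TopologicalSpace M] [TopologicalSpace N]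

variable (m n) in
/-- The space of affine maps from `ℝᵐ` to `ℝⁿ`. -/
abbrev AffineParam : Type :=
  EuclideanSpace ℝ (Fin n) × (EuclideanSpace ℝ (Fin m) →L[ℝ] EuclideanSpace ℝ (Fin n))

/-- The map `g`, read in the chart `φ` of the target, plus `ρ` times an affine function of the
coordinates given by the chart `ψ` of the source. -/
def chartPerturb (g : M → N) (φ : OpenPartialHomeomorph N (EuclideanSpace ℝ (Fin n)))
    (ψ : OpenPartialHomeomorph M (EuclideanSpace ℝ (Fin m))) (ρ : M → ℝ) (s : AffineParam m n)
    (x : M) : EuclideanSpace ℝ (Fin n) :=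
  φ (g x) + ρ x • (s.1 + s.2 (ψ x))

open Classical in
/-- The perturbation of `g` which in the charts `φ`, `ψ` consists in adding `ρ` times an affine
function. -/
def perturb (g : M → N) (φ : OpenPartialHomeomorph N (EuclideanSpace ℝ (Fin n)))
    (ψ : OpenPartialHomeomorph M (EuclideanSpace ℝ (Fin m))) (ρ : M → ℝ) (s : AffineParam m n)
    (x : M) : N :=
  -- Where `g x` leaves the source of `φ`, the chart formula is meaningless; inside it, both
  -- branches agree when `ρ x = 0`.
  if ρ x = 0 then g x else φ.symm (chartPerturb g φ ψ ρ s x)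

variable {g : M → N} {φ : OpenPartialHomeomorph N (EuclideanSpace ℝ (Fin n))}
  {ψ : OpenPartialHomeomorph M (EuclideanSpace ℝ (Fin m))} {ρ : M → ℝ}

theorem perturb_of_eq_zero {s : AffineParam m n} {x : M} (hx : ρ x = 0) :
    perturb g φ ψ ρ s x = g x := if_pos hx

theorem perturb_of_mem_source {s : AffineParam m n} {x : M} (hx : g x ∈ φ.source) :
    perturb g φ ψ ρ s x = φ.symm (chartPerturb g φ ψ ρ s x) := by
  by_cases h : ρ x = 0
  · simp [perturb, chartPerturb, h, hx]
  · simp [perturb, h]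

theorem perturb_zero {x : M} (hx : ρ x ≠ 0 → g x ∈ φ.source) :
    perturb g φ ψ ρ (0 : AffineParam m n) x = g x := by
  by_cases h : ρ x = 0
  · exact perturb_of_eq_zero h
  · simp [perturb_of_mem_source (hx h), chartPerturb, hx h]

variable [ChartedSpace (EuclideanSpace ℝ (Fin m)) M] [ChartedSpace (EuclideanSpace ℝ (Fin n)) N]
  {S : Set N} [ChartedSpace (EuclideanSpace ℝ (Fin k)) S]

theorem contMDiffAt_chartPerturb (hg : ContMDiff (𝓡 m) (𝓡 n) ∞ g)
    (hφ : φ ∈ IsManifold.maximalAtlas (𝓡 n) ∞ N) (hψ : ψ ∈ IsManifold.maximalAtlas (𝓡 m) ∞ M)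
    (hρ : ContMDiff (𝓡 m) 𝓘(ℝ, ℝ) ∞ ρ) {x : M} (hxφ : g x ∈ φ.source) (hxψ : x ∈ ψ.source)
    (s : AffineParam m n) :
    ContMDiffAt ((𝓡 m).prod 𝓘(ℝ, AffineParam m n)) (𝓡 n) ∞
      (fun p : M × AffineParam m n ↦ chartPerturb g φ ψ ρ p.2 p.1) (x, s) := by
  have h1 : ContMDiffAt (𝓡 m) (𝓡 n) ∞ (φ ∘ g) x :=
    (contMDiffAt_of_mem_maximalAtlas hφ hxφ).comp x hg.contMDiffAt
  have h2 : ContMDiffAt (𝓡 m) (𝓡 m) ∞ ψ x := contMDiffAt_of_mem_maximalAtlas hψ hxψ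
  have hfst : ContMDiffAt ((𝓡 m).prod 𝓘(ℝ, AffineParam m n)) (𝓡 m) ∞
      (Prod.fst : M × AffineParam m n → M) (x, s) := contMDiffAt_fst
  have hsnd : ContMDiffAt ((𝓡 m).prod 𝓘(ℝ, AffineParam m n)) 𝓘(ℝ, AffineParam m n) ∞
      (Prod.snd : M × AffineParam m n → AffineParam m n) (x, s) := contMDiffAt_snd
  have ha : ContMDiffAt ((𝓡 m).prod 𝓘(ℝ, AffineParam m n)) (𝓡 n) ∞
      (fun p : M × AffineParam m n ↦ p.2.1) (x, s) :=
    contDiff_fst.contMDiff.contMDiffAt.comp (x, s) hsnd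
  have hb : ContMDiffAt ((𝓡 m).prod 𝓘(ℝ, AffineParam m n))
      𝓘(ℝ, EuclideanSpace ℝ (Fin m) →L[ℝ] EuclideanSpace ℝ (Fin n)) ∞
      (fun p : M × AffineParam m n ↦ p.2.2) (x, s) :=
    contDiff_snd.contMDiff.contMDiffAt.comp (x, s) hsnd
  exact (h1.comp (x, s) hfst).add
    ((hρ.contMDiffAt.comp (x, s) hfst).smul (ha.add (hb.clm_apply (h2.comp (x, s) hfst))))

theorem contMDiffAt_perturb (hg : ContMDiff (𝓡 m) (𝓡 n) ∞ g)
    (hφ : φ ∈ IsManifold.maximalAtlas (𝓡 n) ∞ N) (hψ : ψ ∈ IsManifold.maximalAtlas (𝓡 m) ∞ M)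
    (hρ : ContMDiff (𝓡 m) 𝓘(ℝ, ℝ) ∞ ρ) {x : M} (hxφ : g x ∈ φ.source) (hxψ : x ∈ ψ.source)
    {s : AffineParam m n} (hs : chartPerturb g φ ψ ρ s x ∈ φ.target) :
    ContMDiffAt ((𝓡 m).prod 𝓘(ℝ, AffineParam m n)) (𝓡 n) ∞
      (fun p : M × AffineParam m n ↦ perturb g φ ψ ρ p.2 p.1) (x, s) := by
  have h1 := (contMDiffAt_symm_of_mem_maximalAtlas hφ hs).comp (x, s)
    (contMDiffAt_chartPerturb hg hφ hψ hρ hxφ hxψ s)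
  refine h1.congr_of_eventuallyEq ?_
  have : ∀ᶠ p : M × AffineParam m n in 𝓝 (x, s), g p.1 ∈ φ.source :=
    (hg.continuous.comp continuous_fst).continuousAt (φ.open_source.mem_nhds hxφ)
  filter_upwards [this] with p hp using perturb_of_mem_source hp

theorem contMDiffAt_perturb_of_notMem_tsupport (hg : ContMDiff (𝓡 m) (𝓡 n) ∞ g) {x : M}
    (hx : x ∉ tsupport ρ) (s : AffineParam m n) :
    ContMDiffAt ((𝓡 m).prod 𝓘(ℝ, AffineParam m n)) (𝓡 n) ∞
      (fun p : M × AffineParam m n ↦ perturb g φ ψ ρ p.2 p.1) (x, s) := by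
  refine (hg.contMDiffAt.comp (x, s) contMDiffAt_fst).congr_of_eventuallyEq ?_
  have : ∀ᶠ p : M × AffineParam m n in 𝓝 (x, s), p.1 ∈ (tsupport ρ)ᶜ :=
    continuous_fst.continuousAt ((isClosed_tsupport ρ).isOpen_compl.mem_nhds hx)
  filter_upwards [this] with p hp using perturb_of_eq_zero (image_eq_zero_of_notMem_tsupport hp)

/-- Both conditions are open and hold at `s = 0`; compactness of `K` makes the neighbourhood of `0`
uniform in `x`. -/
theorem eventually_forall_chartPerturb_mem (hg : ContMDiff (𝓡 m) (𝓡 n) ∞ g)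
    (hφ : φ ∈ IsManifold.maximalAtlas (𝓡 n) ∞ N) (hψ : ψ ∈ IsManifold.maximalAtlas (𝓡 m) ∞ M)
    (hρ : ContMDiff (𝓡 m) 𝓘(ℝ, ℝ) ∞ ρ) {K : Set M} (hK : IsCompact K)
    (hKφ : ∀ x ∈ K, g x ∈ φ.source) (hKψ : K ⊆ ψ.source) {O : Set (M × N)} (hO : IsOpen O)
    (hgO : ∀ x, (x, g x) ∈ O) :
    ∀ᶠ s : AffineParam m n in 𝓝 0, ∀ x ∈ K,
      chartPerturb g φ ψ ρ s x ∈ φ.target ∧ (x, perturb g φ ψ ρ s x) ∈ O := by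
  refine hK.eventually_forall_of_forall_eventually fun x hx ↦ ?_
  have h0 : chartPerturb g φ ψ ρ (0 : AffineParam m n) x = φ (g x) := by simp [chartPerturb]
  have ht : chartPerturb g φ ψ ρ (0 : AffineParam m n) x ∈ φ.target :=
    h0 ▸ φ.map_source (hKφ x hx)
  have hp : perturb g φ ψ ρ (0 : AffineParam m n) x = g x := perturb_zero fun _ ↦ hKφ x hx
  have h1 := (contMDiffAt_chartPerturb hg hφ hψ hρ (hKφ x hx) (hKψ hx) 0).continuousAt
  have h2 := (contMDiffAt_perturb hg hφ hψ hρ (hKφ x hx) (hKψ hx) ht).continuousAt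
  have hswap : Filter.Tendsto Prod.swap (𝓝 ((0 : AffineParam m n), x)) (𝓝 (x, 0)) :=
    continuous_swap.continuousAt
  refine (hswap.eventually (h1.eventually (φ.open_target.mem_nhds ht))).and
    (hswap.eventually ((continuousAt_fst.prodMk h2).eventually (hO.mem_nhds ?_)))
  simpa [hp] using hgO x

/-- Carries the Euclidean dimension bound to the manifolds. It is local in `S`, since the slice
description of `S` is available only near `y`. -/
theorem exists_nhds_dimH_not_transverse_le (hg : ContMDiff (𝓡 m) (𝓡 n) ∞ g)
    (hφ : φ ∈ IsManifold.maximalAtlas (𝓡 n) ∞ N) (hψ : ψ ∈ IsManifold.maximalAtlas (𝓡 m) ∞ M)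
    (hρ : ContMDiff (𝓡 m) 𝓘(ℝ, ℝ) ∞ ρ) (hWφ : ∀ x, ρ x ≠ 0 → g x ∈ φ.source)
    (hWψ : ∀ x, ρ x ≠ 0 → x ∈ ψ.source)
    {F : Type*} [NormedAddCommGroup F] [NormedSpace ℝ F] (y : S)
    (hy : Manifold.IsImmersionAtOfComplement F (𝓡 k) (𝓡 n) ∞ (Subtype.val : S → N) y) :
    ∃ U ∈ 𝓝 y, dimH {s : AffineParam m n | ∃ x, ρ x ≠ 0 ∧ chartPerturb g φ ψ ρ s x ∈ φ.target ∧
      ∃ h : perturb g φ ψ ρ s x ∈ S, ⟨_, h⟩ ∈ U ∧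
        ¬ TransverseAt m k n S (perturb g φ ψ ρ s) x}
      ≤ ((finrank ℝ (AffineParam m n) - 1 : ℕ) : ENNReal) := by
  obtain ⟨U, hU, D, Θ, hD, hΘ, hΘ', hslice⟩ := exists_slice hφ y hy
  have : FiniteDimensional ℝ (EuclideanSpace ℝ (Fin k) × F) :=
    hy.equiv.symm.toLinearEquiv.finiteDimensional
  have : FiniteDimensional ℝ F := FiniteDimensional.of_injective
    (LinearMap.inr ℝ (EuclideanSpace ℝ (Fin k)) F) LinearMap.inr_injective
  have hdim : finrank ℝ (EuclideanSpace ℝ (Fin n)) =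
      finrank ℝ (EuclideanSpace ℝ (Fin k)) + finrank ℝ F := by
    rw [← hy.equiv.toLinearEquiv.finrank_eq, finrank_prod]
  let Ω : Set (EuclideanSpace ℝ (Fin m)) := ψ.target ∩ ψ.symm ⁻¹' {x | ρ x ≠ 0}
  have hΩ : IsOpen Ω :=
    ψ.isOpen_inter_preimage_symm (isOpen_ne_fun hρ.continuous continuous_const)
  have hψs : ContMDiffOn (𝓡 m) (𝓡 m) ∞ ψ.symm Ω :=
    (contMDiffOn_symm_of_mem_maximalAtlas hψ).mono inter_subset_left
  have hc : ContDiffOn ℝ ∞ (ρ ∘ ψ.symm) Ω := (hρ.comp_contMDiffOn hψs).contDiffOn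
  have hu : ContDiffOn ℝ ∞ (φ ∘ g ∘ ψ.symm) Ω :=
    ((contMDiffOn_of_mem_maximalAtlas hφ).comp (hg.comp_contMDiffOn hψs)
      fun x hx ↦ hWφ _ hx.2).contDiffOn
  refine ⟨U, hU, (dimH_mono ?_).trans
    (dimH_setOf_not_transverse_le hΩ hu hc (fun x hx ↦ hx.2) hD hΘ hΘ' hdim)⟩
  rintro s ⟨x, hx, hxt, hxS, hxU, hnt⟩
  have hxφ := hWφ x hx
  have hxψ := hWψ x hx
  have hpx : perturb g φ ψ ρ s x = φ.symm (chartPerturb g φ ψ ρ s x) := perturb_of_mem_source hxφ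
  have hps : perturb g φ ψ ρ s x ∈ φ.source := hpx ▸ φ.map_target hxt
  obtain ⟨z, hz, hzx, hle⟩ := hslice _ hxU hps
  have hinv : ψ.symm (ψ x) = x := ψ.left_inv hxψ
  refine ⟨ψ x, ⟨ψ.map_source hxψ, by simpa [hinv] using hx⟩, z, hz, ?_, fun htop ↦ hnt ?_⟩
  · rw [hzx]
    change φ (perturb g φ ψ ρ s x) = _
    rw [hpx, φ.right_inv hxt]
    simp [chartPerturb, hinv]
  have hφd := mdifferentiable_of_mem_maximalAtlas hφ
  have hpair : ContMDiffAt (𝓡 m) ((𝓡 m).prod 𝓘(ℝ, AffineParam m n)) ∞ (fun x' : M ↦ (x', s)) x :=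
    contMDiffAt_id.prodMk contMDiffAt_const
  have hcp : ContMDiffAt (𝓡 m) (𝓡 n) ∞ (chartPerturb g φ ψ ρ s) x :=
    ContMDiffAt.comp (f := fun x' : M ↦ (x', s)) x
      (contMDiffAt_chartPerturb hg hφ hψ hρ hxφ hxψ s) hpair
  have hp : ContMDiffAt (𝓡 m) (𝓡 n) ∞ (perturb g φ ψ ρ s) x :=
    ContMDiffAt.comp (f := fun x' : M ↦ (x', s)) x
      (contMDiffAt_perturb hg hφ hψ hρ hxφ hxψ hxt) hpair
  refine transverseAt_of_chart (hp.mdifferentiableAt (by simp)) hφd hps fun _ ↦ ?_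
  -- Inclusions of the coordinate ranges in the intrinsic ones suffice: enlarging the summands keeps
  -- the sum equal to `⊤`.
  refine eq_top_mono (sup_le_sup hle ?_) htop
  have hev : φ ∘ perturb g φ ψ ρ s =ᶠ[𝓝 x] chartPerturb g φ ψ ρ s := by
    filter_upwards [hg.continuous.continuousAt (φ.open_source.mem_nhds hxφ),
      hcp.continuousAt (φ.open_target.mem_nhds hxt)] with x' h1 h2
    rw [Function.comp_apply, perturb_of_mem_source h1, φ.right_inv h2]
  have hev' : chartPerturb g φ ψ ρ s ∘ ψ.symm =ᶠ[𝓝 (ψ x)] fun x' ↦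
      (φ ∘ g ∘ ψ.symm) x' + (ρ ∘ ψ.symm) x' • (s.1 + s.2 x') := by
    filter_upwards [ψ.open_target.mem_nhds (ψ.map_source hxψ)] with x' hx'
    simp [chartPerturb, ψ.right_inv hx']
  have h1 : HasMFDerivAt (𝓡 m) (𝓡 n) (chartPerturb g φ ψ ρ s) (ψ.symm (ψ x))
      (mfderiv (𝓡 m) (𝓡 n) (φ ∘ perturb g φ ψ ρ s) x) := by
    rw [hinv]
    exact (hcp.mdifferentiableAt (by simp)).hasMFDerivAt.congr_mfderiv hev.mfderiv_eq.symm
  have h2 := ((mdifferentiable_of_mem_maximalAtlas hψ).mdifferentiableAt_symm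
    (ψ.map_source hxψ)).hasMFDerivAt
  obtain ⟨L, hL, hLr⟩ : ∃ L : EuclideanSpace ℝ (Fin m) →L[ℝ] EuclideanSpace ℝ (Fin n),
      HasFDerivAt (fun x' ↦ (φ ∘ g ∘ ψ.symm) x' + (ρ ∘ ψ.symm) x' • (s.1 + s.2 x')) L (ψ x) ∧
      ∀ v, L v ∈ LinearMap.range (mfderiv (𝓡 m) (𝓡 n) (φ ∘ perturb g φ ψ ρ s) x).toLinearMap :=
    ⟨_, hasMFDerivAt_iff_hasFDerivAt.1 ((h1.comp (ψ x) h2).congr_of_eventuallyEq hev'.symm),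
      fun v ↦ ⟨mfderiv (𝓡 m) (𝓡 m) ψ.symm (ψ x) v, rfl⟩⟩
  rintro _ ⟨v, rfl⟩
  have hv := hLr v
  rw [← hL.fderiv] at hv
  exact hv

/-- For a dense set of affine functions, the perturbed map is transverse to `S` wherever the
perturbation is effective. -/
theorem dense_setOf_transverse [SecondCountableTopology N]
    (hS : IsSubmanifold k n S) (hg : ContMDiff (𝓡 m) (𝓡 n) ∞ g)
    (hφ : φ ∈ IsManifold.maximalAtlas (𝓡 n) ∞ N) (hψ : ψ ∈ IsManifold.maximalAtlas (𝓡 m) ∞ M)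
    (hρ : ContMDiff (𝓡 m) 𝓘(ℝ, ℝ) ∞ ρ) (hWφ : ∀ x, ρ x ≠ 0 → g x ∈ φ.source)
    (hWψ : ∀ x, ρ x ≠ 0 → x ∈ ψ.source) :
    Dense {s : AffineParam m n | ∀ x, ρ x ≠ 0 → chartPerturb g φ ψ ρ s x ∈ φ.target →
      TransverseAt m k n S (perturb g φ ψ ρ s) x} := by
  -- For `n = 0` the parameter space is a point and the bound `finrank - 1` truncates to `0`, but
  -- transversality is then automatic.
  rcases Nat.eq_zero_or_pos n with rfl | hn
  · refine dense_univ.mono fun s _ x _ _ _ ↦ ?_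
    have : Subsingleton (Submodule ℝ (EuclideanSpace ℝ (Fin 0))) := inferInstance
    exact this.elim _ _
  obtain ⟨F, _, _, hF⟩ := hS.isSmoothEmbedding.isImmersion
  choose U hU hUdim using fun y ↦
    exists_nhds_dimH_not_transverse_le hg hφ hψ hρ hWφ hWψ y (hF y)
  -- `S` is second countable, so countably many of the local bounds cover it, and Hausdorff
  -- dimension is stable under countable unions.
  obtain ⟨t, htc, ht⟩ := TopologicalSpace.countable_cover_nhds hU
  have : Countable t := htc.to_subtype
  have hpos : 0 < finrank ℝ (AffineParam m n) := by
    rw [finrank_prod, finrank_euclideanSpace_fin]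
    omega
  refine (dense_compl_iUnion_of_dimH_le hpos fun y : t ↦ hUdim y).mono ?_
  intro s hs x hx hxt
  by_contra hnt
  have hxS : perturb g φ ψ ρ s x ∈ S := by
    by_contra h
    exact hnt fun h' ↦ (h h').elim
  obtain ⟨y, hyt, hy⟩ := mem_iUnion₂.1 (ht ▸ mem_univ (⟨_, hxS⟩ : S))
  exact hs (mem_iUnion.2 ⟨⟨y, hyt⟩, x, hx, hxt, hxS, hy, hnt⟩)

/-- A smooth map can be made transverse to `S` on a relatively compact open set `W` contained in
a chart and mapped to a chart, by a homotopy which is constant outside of `W`, and which destroys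
transversality at no point. -/
theorem exists_transverse_step [IsManifold (𝓡 m) ∞ M] [T2Space M] [SecondCountableTopology M]
    [SecondCountableTopology N] (hS : IsSubmanifold k n S) (hg : ContMDiff (𝓡 m) (𝓡 n) ∞ g)
    (hφ : φ ∈ IsManifold.maximalAtlas (𝓡 n) ∞ N) (hψ : ψ ∈ IsManifold.maximalAtlas (𝓡 m) ∞ M)
    {W : Set M} (hW : IsOpen W) (hWc : IsCompact (closure W)) (hWψ : closure W ⊆ ψ.source)
    (hWφ : ∀ x ∈ closure W, g x ∈ φ.source) {O : Set (M × N)} (hO : IsOpen O)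
    (hgO : ∀ x, (x, g x) ∈ O) :
    ∃ g' : M → N, ContMDiff (𝓡 m) (𝓡 n) ∞ g' ∧ (∀ x, (x, g' x) ∈ O) ∧
      (∀ x ∈ W, TransverseAt m k n S g' x) ∧
      (∀ x, TransverseAt m k n S g x → TransverseAt m k n S g' x) ∧
      ∃ H : M × ℝ → N, ContinuousOn H (univ ×ˢ Icc 0 1) ∧ (∀ x, H (x, 0) = g x) ∧
        (∀ x, H (x, 1) = g' x) ∧ ∀ x ∉ W, ∀ t, H (x, t) = g x := by
  have : LocallyCompactSpace M := ChartedSpace.locallyCompactSpace (EuclideanSpace ℝ (Fin m)) M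
  obtain ⟨ρ, hρW, hρ, hρ0⟩ := hW.exists_contMDiff_support_eq (n := ⊤) (𝓡 m)
  have hρW' (x : M) : ρ x ≠ 0 ↔ x ∈ W := by rw [← hρW, Function.mem_support]
  have hts : tsupport ρ = closure W := by rw [tsupport, hρW]
  obtain ⟨δ, hδ, hball⟩ := Metric.eventually_nhds_iff_ball.1
    (eventually_forall_chartPerturb_mem (m := m) (ρ := ρ) hg hφ hψ hρ hWc hWφ hWψ hO hgO)
  obtain ⟨s, hs, hsδ⟩ := (dense_setOf_transverse hS hg hφ hψ hρ
    (fun x hx ↦ hWφ x (subset_closure ((hρW' x).1 hx)))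
    (fun x hx ↦ hWψ (subset_closure ((hρW' x).1 hx)))).inter_open_nonempty _
      Metric.isOpen_ball ⟨0, Metric.mem_ball_self hδ⟩ |>.imp fun _ h ↦ h.symm
  have hsmooth (s' : AffineParam m n) (hs' : s' ∈ Metric.ball 0 δ) (x : M) :
      ContMDiffAt ((𝓡 m).prod 𝓘(ℝ, AffineParam m n)) (𝓡 n) ∞
        (fun p : M × AffineParam m n ↦ perturb g φ ψ ρ p.2 p.1) (x, s') := by
    by_cases hx : x ∈ closure W
    · exact contMDiffAt_perturb hg hφ hψ hρ (hWφ x hx) (hWψ hx) (hball s' hs' x hx).1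
    · exact contMDiffAt_perturb_of_notMem_tsupport hg (hts ▸ hx) s'
  have hoff (s' : AffineParam m n) (x : M) (hx : x ∉ W) : perturb g φ ψ ρ s' x = g x :=
    perturb_of_eq_zero (not_not.1 (mt (hρW' x).1 hx))
  have honW (x : M) (hx : x ∈ W) : TransverseAt m k n S (perturb g φ ψ ρ s) x :=
    hs x ((hρW' x).2 hx) (hball s hsδ x (subset_closure hx)).1
  refine ⟨perturb g φ ψ ρ s, fun x ↦ ContMDiffAt.comp (f := fun x' : M ↦ (x', s)) x
    (hsmooth s hsδ x) (contMDiffAt_id.prodMk contMDiffAt_const), fun x ↦ ?_, honW, fun x hx ↦ ?_,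
    fun p ↦ perturb g φ ψ ρ (p.2 • s) p.1, ?_, fun x ↦ ?_, fun x ↦ ?_, fun x hx t ↦ hoff _ x hx⟩
  · by_cases hx : x ∈ W
    · exact (hball s hsδ x (subset_closure hx)).2
    · rw [hoff s x hx]
      exact hgO x
  · by_cases hxW : x ∈ W
    · exact honW x hxW
    by_cases hxc : x ∈ closure W
    · have hρx : ρ x = 0 := not_not.1 (mt (hρW' x).1 hxW)
      have hψx : MDifferentiableAt (𝓡 m) (𝓡 m) ψ x :=
        (mdifferentiable_of_mem_maximalAtlas hψ).mdifferentiableAt (hWψ hxc)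
      refine hx.perturb (hg.mdifferentiable (by simp) x)
        (mdifferentiable_of_mem_maximalAtlas hφ) (hWφ x hxc)
        (β := fun y ↦ ρ y • (s.1 + s.2 (ψ y))) (by simp [hρx])
        (hasMFDerivAt_smul_zero (hρ.mdifferentiable (by simp) x) hρx hρ0 ?_) ?_
      · exact mdifferentiableAt_const.add
          (s.2.differentiableAt.mdifferentiableAt.comp x hψx)
      · filter_upwards [hg.continuous.continuousAt (φ.open_source.mem_nhds (hWφ x hxc))] with y hy
        exact perturb_of_mem_source hy
    · refine hx.congr_of_eventuallyEq ?_
      filter_upwards [isClosed_closure.isOpen_compl.mem_nhds hxc] with y hy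
      exact hoff s y fun h ↦ hy (subset_closure h)
  · rintro ⟨x, t⟩ ⟨-, ht⟩
    have hts : t • s ∈ Metric.ball 0 δ := by
      rw [mem_ball_zero_iff] at hsδ ⊢
      rw [norm_smul, Real.norm_of_nonneg ht.1]
      exact (mul_le_of_le_one_left (norm_nonneg _) ht.2).trans_lt hsδ
    have h1 : ContinuousAt (fun p : M × ℝ ↦ (p.1, p.2 • s)) (x, t) := by fun_prop
    exact (ContinuousAt.comp (f := fun p : M × ℝ ↦ (p.1, p.2 • s)) (x := (x, t))
      (hsmooth _ hts x).continuousAt h1).continuousWithinAt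
  · exact (congrArg (perturb g φ ψ ρ · x) (zero_smul ℝ s)).trans
      (perturb_zero fun hx ↦ hWφ x (subset_closure ((hρW' x).1 hx)))
  · exact congrArg (perturb g φ ψ ρ · x) (one_smul ℝ s)

end Perturbation

/-! ### Concatenation of infinitely many homotopies. -/

section Limit

variable {X Y : Type*}

/-- The homotopies `H i` performed one after the other, the `i`-th one during the time interval
`[1 - 2⁻ⁱ, 1 - 2⁻ⁱ⁻¹]`, and only the first `n` ones. -/
def concatHomotopies (g₀ : X → Y) (H : ℕ → X × ℝ → Y) : ℕ → X × ℝ → Y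
  | 0, p => g₀ p.1
  | n + 1, p =>
    -- The affine function of time below maps `[1 - 2⁻ⁿ, 1 - 2⁻ⁿ⁻¹]` onto `[0, 1]`; clamping freezes
    -- the homotopy at its end afterwards.
    if p.2 ≤ 1 - 2⁻¹ ^ n then concatHomotopies g₀ H n p
    else H n (p.1, projIcc (0 : ℝ) 1 zero_le_one (2 ^ (n + 1) * (p.2 - 1) + 2))

variable {g : ℕ → X → Y} {H : ℕ → X × ℝ → Y}

theorem concatHomotopies_of_le (H1 : ∀ i x, H i (x, 1) = g (i + 1) x) (n : ℕ) (x : X) {t : ℝ}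
    (ht : 1 - 2⁻¹ ^ n ≤ t) : concatHomotopies (g 0) H n (x, t) = g n x := by
  cases n with
  | zero => rfl
  | succ n =>
    have h2 : (0 : ℝ) < 2⁻¹ ^ n := by positivity
    have h3 : (2 : ℝ) ^ n * 2⁻¹ ^ n = 1 := by rw [← mul_pow]; norm_num
    rw [pow_succ] at ht
    have h4 : ¬ t ≤ 1 - 2⁻¹ ^ n := by linarith
    have h5 : (1 : ℝ) ≤ 2 ^ (n + 1) * (t - 1) + 2 := by
      have : (2 : ℝ) ^ n * (1 - 2⁻¹ ^ n * 2⁻¹) ≤ 2 ^ n * t := by gcongr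
      rw [pow_succ]
      linarith
    simp only [concatHomotopies, h4, if_false, projIcc_of_right_le zero_le_one h5, H1]

theorem concatHomotopies_zero (n : ℕ) (x : X) : concatHomotopies (g 0) H n (x, 0) = g 0 x := by
  induction n with
  | zero => rfl
  | succ n ih =>
    have : (0 : ℝ) ≤ 1 - 2⁻¹ ^ n := sub_nonneg.2 (pow_le_one₀ (by norm_num) (by norm_num))
    simp only [concatHomotopies, this, if_true, ih]

variable [TopologicalSpace X] [TopologicalSpace Y]

theorem continuous_concatHomotopies (hg : Continuous (g 0))
    (hH : ∀ i, ContinuousOn (H i) (univ ×ˢ Icc 0 1)) (H0 : ∀ i x, H i (x, 0) = g i x)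
    (H1 : ∀ i x, H i (x, 1) = g (i + 1) x) (n : ℕ) :
    Continuous (concatHomotopies (g 0) H n) := by
  induction n with
  | zero => exact hg.comp continuous_fst
  | succ n ih =>
    refine Continuous.if_le ih ((hH n).comp_continuous (by fun_prop) fun p ↦
      ⟨mem_univ _, Subtype.prop _⟩) continuous_snd continuous_const ?_
    rintro ⟨x, t⟩ (rfl : t = 1 - 2⁻¹ ^ n)
    have h3 : (2 : ℝ) ^ n * 2⁻¹ ^ n = 1 := by rw [← mul_pow]; norm_num
    have h5 : (2 : ℝ) ^ (n + 1) * (1 - 2⁻¹ ^ n - 1) + 2 ≤ 0 := by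
      rw [pow_succ]
      linarith
    rw [concatHomotopies_of_le H1 n x le_rfl]
    simp only [projIcc_of_le_left zero_le_one h5, H0]

/-- Infinitely many successive homotopies supported in a locally finite family of sets have
a limit, which is homotopic to the initial map. -/
theorem exists_limit_homotopy {W : ℕ → Set X} (hW : LocallyFinite W) (hg : Continuous (g 0))
    (hH : ∀ i, ContinuousOn (H i) (univ ×ˢ Icc 0 1)) (H0 : ∀ i x, H i (x, 0) = g i x)
    (H1 : ∀ i x, H i (x, 1) = g (i + 1) x) (Hoff : ∀ i, ∀ x ∉ W i, ∀ t, H i (x, t) = g i x) :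
    ∃ G : X × ℝ → Y, Continuous G ∧ (∀ x, G (x, 0) = g 0 x) ∧
      ∀ x, ∀ᶠ n in atTop, g n =ᶠ[𝓝 x] fun x ↦ G (x, 1) := by
  -- Consecutive concatenations differ only over `W n`, so near every point, even at time `1`, only
  -- finitely many changes occur.
  have hlf : LocallyFinite fun n ↦
      {p | concatHomotopies (g 0) H (n + 1) p ≠ concatHomotopies (g 0) H n p} := by
    refine (hW.preimage_continuous continuous_fst).subset fun n p hp ↦ ?_
    by_contra hpW
    refine hp ?_
    rw [concatHomotopies]
    split_ifs with h
    · rfl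
    · rw [Hoff n p.1 hpW, ← concatHomotopies_of_le H1 n p.1 (not_le.1 h).le]
  obtain ⟨G, hG⟩ := hlf.exists_forall_eventually_atTop_eventuallyEq
  refine ⟨G, continuous_iff_continuousAt.2 fun p ↦ ?_, fun x ↦ ?_, fun x ↦ ?_⟩
  · obtain ⟨n, hn⟩ := (hG p).exists
    exact (continuous_concatHomotopies hg hH H0 H1 n).continuousAt.congr hn
  · obtain ⟨n, hn⟩ := (hG (x, 0)).exists
    rw [← hn.eq_of_nhds, concatHomotopies_zero]
  · filter_upwards [hG (x, 1)] with n hn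
    have : Tendsto (fun x : X ↦ (x, (1 : ℝ))) (𝓝 x) (𝓝 (x, 1)) :=
      (Continuous.prodMk_left 1).continuousAt
    filter_upwards [this.eventually hn] with x' hx'
    rw [← hx', concatHomotopies_of_le H1 n x' (sub_le_self _ (by positivity))]

end Limit

/-! ### Chart covers and the global construction. -/

section Main

variable {m k n : ℕ} {M N : Type*}
  [TopologicalSpace M] [T2Space M] [SecondCountableTopology M]
  [ChartedSpace (EuclideanSpace ℝ (Fin m)) M] [IsManifold (𝓡 m) ∞ M]
  [TopologicalSpace N] [ChartedSpace (EuclideanSpace ℝ (Fin n)) N] [IsManifold (𝓡 n) ∞ N]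

/-- A countable locally finite covering of the source of a continuous map by relatively compact
open sets, contained in charts and mapped into charts. -/
theorem exists_chart_cover {f : M → N} (hf : Continuous f) [Nonempty M] :
    ∃ (W : ℕ → Set M) (φ : ℕ → OpenPartialHomeomorph N (EuclideanSpace ℝ (Fin n)))
      (ψ : ℕ → OpenPartialHomeomorph M (EuclideanSpace ℝ (Fin m))),
      LocallyFinite W ∧ (∀ i, IsOpen (W i)) ∧ ⋃ i, W i = univ ∧
      (∀ i, IsCompact (closure (W i))) ∧ (∀ i, closure (W i) ⊆ (ψ i).source) ∧
      (∀ i, ∀ x ∈ closure (W i), f x ∈ (φ i).source) ∧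
      (∀ i, φ i ∈ IsManifold.maximalAtlas (𝓡 n) ∞ N) ∧
      ∀ i, ψ i ∈ IsManifold.maximalAtlas (𝓡 m) ∞ M := by
  have : LocallyCompactSpace M := ChartedSpace.locallyCompactSpace (EuclideanSpace ℝ (Fin m)) M
  obtain ⟨ι, fs, hfs⟩ := SmoothBumpCovering.exists_isSubordinate (𝓡 m) (isClosed_univ (X := M))
    (U := fun x ↦ f ⁻¹' (chartAt (EuclideanSpace ℝ (Fin n)) (f x)).source)
    fun x _ ↦ hf.continuousAt (chart_source_mem_nhds _ (f x))
  have hι : Countable ι := countable_univ_iff.1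
    (fs.locallyFinite.countable_univ fun i ↦ (fs i).nonempty_support)
  obtain ⟨e, he⟩ := exists_injective_nat ι
  let x₀ : M := Classical.arbitrary M
  -- Reindexing by `ℕ` pads the family with empty sets, for which every requirement is trivial.
  let W : ℕ → Set M := Function.extend e (fun i ↦ Function.support (fs i)) fun _ ↦ ∅
  let c : ℕ → M := Function.extend e fs.c fun _ ↦ x₀
  have hWe (i : ι) : W (e i) = Function.support (fs i) := he.extend_apply _ _ i
  have hce (i : ι) : c (e i) = fs.c i := he.extend_apply _ _ i
  have hW0 (j : ℕ) (hj : ¬ ∃ i, e i = j) : W j = ∅ := Function.extend_apply' _ _ j hj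
  have hind (P : Set M → M → Prop) (h0 : ∀ x, P ∅ x)
      (h : ∀ i, P (Function.support (fs i)) (fs.c i)) (j : ℕ) : P (W j) (c j) := by
    by_cases hj : ∃ i, e i = j
    · obtain ⟨i, rfl⟩ := hj
      rw [hWe, hce]
      exact h i
    · rw [hW0 j hj]
      exact h0 _
  refine ⟨W, fun j ↦ chartAt _ (f (c j)), fun j ↦ chartAt _ (c j), fun x ↦ ?_,
    hind (fun W _ ↦ IsOpen W) (fun _ ↦ isOpen_empty) fun i ↦ (fs i).isOpen_support, ?_,
    hind (fun W _ ↦ IsCompact (closure W)) (by simp) fun i ↦ (fs i).hasCompactSupport,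
    hind (fun W x ↦ closure W ⊆ (chartAt _ x).source) (by simp)
      fun i ↦ (fs i).tsupport_subset_chartAt_source,
    hind (fun W x ↦ ∀ x' ∈ closure W, f x' ∈ (chartAt _ (f x)).source) (by simp) fun i ↦ hfs i,
    fun j ↦ IsManifold.chart_mem_maximalAtlas _, fun j ↦ IsManifold.chart_mem_maximalAtlas _⟩
  · obtain ⟨t, ht, hfin⟩ := fs.locallyFinite x
    refine ⟨t, ht, (hfin.image e).subset fun j hj ↦ ?_⟩
    by_cases h : ∃ i, e i = j
    · obtain ⟨i, rfl⟩ := h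
      exact ⟨i, by simpa only [mem_ofPred_eq, hWe] using hj, rfl⟩
    · simp [hW0 j h] at hj
  · refine eq_univ_of_forall fun x ↦ mem_iUnion.2 ⟨e (fs.ind x (mem_univ x)), ?_⟩
    rw [hWe]
    exact fs.mem_support_ind x (mem_univ x)

variable [SecondCountableTopology N] {S : Set N} [ChartedSpace (EuclideanSpace ℝ (Fin k)) S]

theorem exists_homotopic_transverse (hS : IsSubmanifold k n S) (f : C(M, N))
    (hf : ContMDiff (𝓡 m) (𝓡 n) ∞ f) {A : Set M} (hA : IsClosed A)
    (hfA : TransverseOn m k n S f A) :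
    ∃ g : C(M, N), ContMDiff (𝓡 m) (𝓡 n) ∞ g ∧ f.Homotopic g ∧ Transverse m k n S g ∧
      EqOn g f A := by
  rcases isEmpty_or_nonempty M with hM | hM
  · exact ⟨f, hf, .refl f, fun x ↦ hM.elim x, eqOn_refl _ _⟩
  obtain ⟨W, φ, ψ, hlf, hWo, hWu, hWc, hWψ, hWφ, hφ, hψ⟩ :=
    exists_chart_cover (m := m) (n := n) f.continuous
  -- the maps close to `f`
  let O : Set (M × N) := (⋃ i, closure (W i) ×ˢ (φ i).sourceᶜ)ᶜ
  -- Local finiteness makes the union of the forbidden closed sets closed. Graphs in `O` keep each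
  -- `closure (W i)` mapped into its chart, so the same charts serve at every stage.
  have hO : IsOpen O := ((hlf.closure.prod_right _).isClosed_iUnion fun i ↦
    isClosed_closure.prod (φ i).open_source.isClosed_compl).isOpen_compl
  have hOφ {x : M} {y : N} (h : (x, y) ∈ O) (i : ℕ) (hx : x ∈ closure (W i)) :
      y ∈ (φ i).source := by
    by_contra hy
    exact h (mem_iUnion.2 ⟨i, hx, hy⟩)
  have hfO (x : M) : (x, f x) ∈ O := fun h ↦ by
    obtain ⟨i, hx, hy⟩ := mem_iUnion.1 h
    exact hy (hWφ i x hx)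
  have hcl (i : ℕ) : closure (W i \ A) ⊆ closure (W i) := closure_mono sdiff_subset
  have step (i : ℕ) (g : {g : M → N // ContMDiff (𝓡 m) (𝓡 n) ∞ g ∧ ∀ x, (x, g x) ∈ O}) :
      ∃ g' : {g : M → N // ContMDiff (𝓡 m) (𝓡 n) ∞ g ∧ ∀ x, (x, g x) ∈ O},
        (∀ x ∈ W i \ A, TransverseAt m k n S g'.1 x) ∧
        (∀ x, TransverseAt m k n S g.1 x → TransverseAt m k n S g'.1 x) ∧
        ∃ H : M × ℝ → N, ContinuousOn H (univ ×ˢ Icc 0 1) ∧ (∀ x, H (x, 0) = g.1 x) ∧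
          (∀ x, H (x, 1) = g'.1 x) ∧ ∀ x ∉ W i \ A, ∀ t, H (x, t) = g.1 x := by
    obtain ⟨g', h1, h2, h3, h4, h5⟩ := exists_transverse_step hS g.2.1 (hφ i) (hψ i)
      ((hWo i).sdiff hA) ((hWc i).of_isClosed_subset isClosed_closure (hcl i))
      ((hcl i).trans (hWψ i)) (fun x hx ↦ hOφ (g.2.2 x) i (hcl i hx)) hO g.2.2
    exact ⟨⟨g', h1, h2⟩, h3, h4, h5⟩
  choose next hnextW hnext H hHc hH0 hH1 hHoff using step
  let g : ℕ → {g : M → N // ContMDiff (𝓡 m) (𝓡 n) ∞ g ∧ ∀ x, (x, g x) ∈ O} :=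
    fun i ↦ Nat.rec ⟨f, hf, hfO⟩ next i
  have hlf' : LocallyFinite fun i ↦ W i \ A := hlf.subset fun i ↦ sdiff_subset
  obtain ⟨G, hGc, hG0, hG⟩ := exists_limit_homotopy (g := fun i ↦ (g i).1)
    (H := fun i ↦ H i (g i)) hlf' f.continuous (fun i ↦ hHc i (g i)) (fun i ↦ hH0 i (g i))
    (fun i ↦ hH1 i (g i)) fun i ↦ hHoff i (g i)
  have hmono (x : M) (i j : ℕ) (hij : i ≤ j) (hx : TransverseAt m k n S (g i).1 x) :
      TransverseAt m k n S (g j).1 x := by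
    induction j, hij using Nat.le_induction with
    | base => exact hx
    | succ j _ ih => exact hnext j (g j) x ih
  have hgA (i : ℕ) (x : M) (hx : x ∈ A) : (g i).1 x = f x := by
    induction i with
    | zero => rfl
    | succ i ih =>
      exact ((hH1 i (g i) x).symm.trans (hHoff i (g i) x (fun h ↦ h.2 hx) 1)).trans ih
  refine ⟨⟨fun x ↦ G (x, 1), by fun_prop⟩, fun x ↦ ?_, ⟨⟨⟨fun p ↦ G (p.2, p.1), by fun_prop⟩,
    fun x ↦ hG0 x, fun x ↦ rfl⟩⟩, fun x ↦ ?_, fun x hx ↦ ?_⟩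
  · obtain ⟨i, hi⟩ := (hG x).exists
    exact (g i).2.1.contMDiffAt.congr_of_eventuallyEq hi.symm
  -- Points of `A` are good from stage `0`, points of `W i \ A` from stage `i + 1`; goodness
  -- persists until the maps have stabilised near `x`.
  · obtain ⟨i, hi⟩ : ∃ i, TransverseAt m k n S (g i).1 x := by
      by_cases hx : x ∈ A
      · exact ⟨0, hfA x hx⟩
      · obtain ⟨i, hi⟩ := mem_iUnion.1 (hWu ▸ mem_univ x)
        exact ⟨i + 1, hnextW i (g i) x ⟨hi, hx⟩⟩
    obtain ⟨j, hj, hij⟩ := ((hG x).and (eventually_ge_atTop i)).exists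
    exact (hmono x i j hij hi).congr_of_eventuallyEq hj.symm
  · obtain ⟨i, hi⟩ := (hG x).exists
    exact hi.eq_of_nhds.symm.trans (hgA i x hx)

end Main

end Transversality

end

theorem corollary2 {m k n : ℕ} {M N : Type*}
    [TopologicalSpace M] [T2Space M] [SecondCountableTopology M]
    [ChartedSpace (EuclideanSpace ℝ (Fin m)) M] [IsManifold (𝓡 m) ∞ M]
    [TopologicalSpace N] [T2Space N] [SecondCountableTopology N]
    [ChartedSpace (EuclideanSpace ℝ (Fin n)) N] [IsManifold (𝓡 n) ∞ N]
    (S : Set N) [ChartedSpace (EuclideanSpace ℝ (Fin k)) S]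
    (hS : Transversality.IsSubmanifold k n S)
    (f : C(M, N)) (hf : ContMDiff (𝓡 m) (𝓡 n) ∞ f) :
    (∃ g : C(M, N), ContMDiff (𝓡 m) (𝓡 n) ∞ g ∧ f.Homotopic g ∧
      Transversality.Transverse m k n S g) ∧
    ∀ A : Set M, IsClosed A → Transversality.TransverseOn m k n S f A →
      ∃ g : C(M, N), ContMDiff (𝓡 m) (𝓡 n) ∞ g ∧ f.Homotopic g ∧
        Transversality.Transverse m k n S g ∧ Set.EqOn g f A := by
  refine ⟨?_, fun A hA hfA ↦ Transversality.exists_homotopic_transverse hS f hf hA hfA⟩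
  obtain ⟨g, hg, hfg, hgS, -⟩ := Transversality.exists_homotopic_transverse hS f hf isClosed_empty
    fun x hx ↦ hx.elim
  exact ⟨g, hg, hfg, hgS⟩
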